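/- Let $K_0$ be a nonempty compact convex subset of the Euclidean plane $\mathbb{R}^2$, and write $\operatorname{conv}(X)$ for the convex hull of a set $X\subseteq\mathbb{R}^2$. A disk is a closed disk of radius $r\ge 0$ (so singletons are disks). A set $K_1$ is similar (respectively isometric) to $K_0$ if it is the image of $K_0$ under a similarity transformation of positive ratio (respectively an isometry, possibly orientation-reversing) of the plane onto itself. Then the following three conditions are equivalent. (a) $K_0$ is a disk. (b) For every $K_1\subseteq\mathbb{R}^2$ and for arbitrary points $A_0,A_1,A_2\in\mathbb{R}^2$, if $K_1$ is similar to $K_0$ and both $K_0$ and $K_1$ are contained in the (possibly degenerate) triangle $\operatorname{conv}(\{A_0,A_1,A_2\})$, then there exist $j\in\{0,1,2\}$ and $k\in\{0,1\}$ such that $K_{1-k}\subseteq\operatorname{conv}\bigl(K_k\cup(\{A_0,A_1,A_2\}\setminus\{A_j\})\bigr)$. (c) The same as (b), with "similar" replaced by "isometric". -/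

import Mathlib

/-- The Euclidean plane. -/
abbrev Plane : Type := EuclideanSpace ℝ (Fin 2)

/-- A disk: a closed ball of radius `r ≥ 0`; singletons (`r = 0`) are disks, the empty set is not. -/
def IsDisk (K : Set Plane) : Prop :=
  ∃ (c : Plane) (r : ℝ), 0 ≤ r ∧ K = Metric.closedBall c r

/-- `Y` is the image of `X` under a similarity transformation of the plane
(a bijection that multiplies all distances by one fixed positive ratio). -/
def SimilarSets (X Y : Set Plane) : Prop :=
  ∃ φ : Plane ≃ᵈ Plane, Y = φ '' X

/-- `Y` is the image of `X` under an isometric transformation of the plane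
(orientation-reversing ones included). -/
def IsometricSets (X Y : Set Plane) : Prop :=
  ∃ φ : Plane ≃ᵢ Plane, Y = φ '' X

/-- Some member of the pair `K 0`, `K 1` is contained in the convex hull of the other one together
with the set `{A 0, A 1, A 2}` from which one of the three points has been removed. -/
def CarouselConclusion (K : Fin 2 → Set Plane) (A : Fin 3 → Plane) : Prop :=
  ∃ (j : Fin 3) (k : Fin 2),
    K (1 - k) ⊆ convexHull ℝ (K k ∪ (({A 0, A 1, A 2} : Set Plane) \ {A j}))

/-- The weak carousel property of `K₀` relative to a relation `R` between planar sets. The points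
`A 0`, `A 1`, `A 2` are arbitrary; degenerate triangles are allowed. -/
def WeakCarousel (R : Set Plane → Set Plane → Prop) (K₀ : Set Plane) : Prop :=
  ∀ (K₁ : Set Plane) (A : Fin 3 → Plane), R K₀ K₁ →
    K₀ ⊆ convexHull ℝ {A 0, A 1, A 2} → K₁ ⊆ convexHull ℝ {A 0, A 1, A 2} →
      CarouselConclusion ![K₀, K₁] A

/-! Disk implies carousel: suppose disks of radii r₀ ≤ r₁ with centers c₀, c₁ violate the
conclusion. Separation gives, at each vertex `A j`, two unit directions maximized strictly there
among the vertices: in one, disk 0 reaches beyond disk 1; in the other, the reverse. Write c₀ - c₁ =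
∑ lᵢ Aᵢ with ∑ lᵢ = 0. Either two weights are nonnegative, which contradicts the first direction at
the third vertex, or two are negative, and then `planeForm_comb_ge_of_normal_cones` contradicts the
second direction there.

Isometric carousel implies disk: test K against its mirror image σK in a horizontal line, inside an
isosceles triangle symmetric about that line and tight around K ∪ σK. If K leans one way on the
slanted sides and the other way on the vertical side, every inclusion fails. After vertical
translations this forces the asymmetry h(a, b) - h(a, -b) of the support function h to be linear in
b with a coefficient independent of a (`WeakCarousel.supportValue_sub`): K has a horizontal symmetry
axis. Applied to all rotations of K, this makes h constant on unit vectors once K is centered. -/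

open Set Metric Filter Topology

/-! ### Linear functionals on the plane, separation, compactness of hulls. -/

/-- The value at `x` of the linear functional with coefficients `a`, `b`. -/
def planeForm (a b : ℝ) (x : Plane) : ℝ := a * x 0 + b * x 1

theorem plane_ext {x y : Plane} (h₀ : x 0 = y 0) (h₁ : x 1 = y 1) : x = y := by
  ext i
  fin_cases i
  · exact h₀
  · exact h₁

theorem plane_norm_sq (x : Plane) : ‖x‖ ^ 2 = x 0 ^ 2 + x 1 ^ 2 := by
  rw [EuclideanSpace.real_norm_sq_eq, Fin.sum_univ_two]

theorem plane_dist_sq (x y : Plane) : dist x y ^ 2 = (x 0 - y 0) ^ 2 + (x 1 - y 1) ^ 2 := by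
  rw [dist_eq_norm, plane_norm_sq]
  simp

theorem planeForm_convex_comb (a b s t : ℝ) (x y : Plane) :
    planeForm a b (s • x + t • y) = s * planeForm a b x + t * planeForm a b y := by
  simp only [planeForm, PiLp.add_apply, PiLp.smul_apply, smul_eq_mul]
  ring

theorem continuous_planeForm (a b : ℝ) : Continuous (planeForm a b) := by
  unfold planeForm
  fun_prop

theorem planeForm_lt_of_mem_convexHull {S : Set Plane} {a b r : ℝ}
    (h : ∀ y ∈ S, planeForm a b y < r) {x : Plane} (hx : x ∈ convexHull ℝ S) :
    planeForm a b x < r := by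
  have hc : Convex ℝ {y | planeForm a b y < r} := by
    intro y hy z hz s t hs ht hst
    simp only [mem_ofPred_eq] at hy hz ⊢
    rw [planeForm_convex_comb]
    rcases hs.eq_or_lt with rfl | hs
    · obtain rfl : t = 1 := by linarith
      simpa using hz
    · calc s * planeForm a b y + t * planeForm a b z < s * r + t * r := by
            have := mul_lt_mul_of_pos_left hy hs
            have := mul_le_mul_of_nonneg_left hz.le ht
            linarith
        _ = r := by rw [← add_mul, hst, one_mul]
  exact convexHull_min (s := S) (t := {y | planeForm a b y < r}) h hc hx

theorem exists_planeForm_eq (f : StrongDual ℝ Plane) : ∃ a b, ∀ x, f x = planeForm a b x := by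
  refine ⟨f (!₂[1, 0]), f (!₂[0, 1]), fun x => ?_⟩
  have hx : x = x 0 • !₂[1, 0] + x 1 • !₂[0, 1] := by
    apply plane_ext <;> simp
  conv_lhs => rw [hx]
  simp [planeForm, mul_comm]

/-- A point outside a nonempty closed convex set is strictly separated from it by a unit
functional. -/
theorem exists_unit_planeForm_lt {S : Set Plane} (hne : S.Nonempty) (hc : Convex ℝ S)
    (hcl : IsClosed S) {x : Plane} (hx : x ∉ S) :
    ∃ a b, a ^ 2 + b ^ 2 = 1 ∧ ∀ y ∈ S, planeForm a b y < planeForm a b x := by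
  obtain ⟨f, u, hf, hu⟩ := geometric_hahn_banach_closed_point hc hcl hx
  obtain ⟨a, b, hab⟩ := exists_planeForm_eq f
  obtain ⟨z, hz⟩ := hne
  have hpos : 0 < a ^ 2 + b ^ 2 := by
    by_contra! h
    have ha : a = 0 := by nlinarith
    have hb : b = 0 := by nlinarith
    have := (hf z hz).trans hu
    simp [hab, ha, hb, planeForm] at this
  have hr := Real.sqrt_pos.2 hpos
  refine ⟨a / √(a ^ 2 + b ^ 2), b / √(a ^ 2 + b ^ 2), ?_, fun y hy => ?_⟩
  · rw [div_pow, div_pow, Real.sq_sqrt hpos.le, ← add_div, div_self hpos.ne']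
  · have := (hf y hy).trans hu
    rw [hab, hab] at this
    have h : ∀ w, planeForm (a / √(a ^ 2 + b ^ 2)) (b / √(a ^ 2 + b ^ 2)) w
        = planeForm a b w / √(a ^ 2 + b ^ 2) := fun w => by
      simp only [planeForm]; ring
    rw [h, h]
    gcongr

theorem isCompact_convexHull_union {E : Type*} [AddCommGroup E] [Module ℝ E] [TopologicalSpace E]
    [IsTopologicalAddGroup E] [ContinuousSMul ℝ E] {S T : Set E}
    (hS : IsCompact S) (hSc : Convex ℝ S) (hT : T.Finite) :
    IsCompact (convexHull ℝ (S ∪ T)) := by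
  rcases S.eq_empty_or_nonempty with rfl | hSn
  · simpa using hT.isCompact_convexHull ℝ
  rcases T.eq_empty_or_nonempty with rfl | hTn
  · simpa [hSc.convexHull_eq] using hS
  rw [convexHull_union hSn hTn, hSc.convexHull_eq]
  -- The join is a continuous image of the compact set [0,1] × S × conv T.
  have himg : convexJoin ℝ S (convexHull ℝ T)
      = (fun p : ℝ × E × E => (1 - p.1) • p.2.1 + p.1 • p.2.2) ''
        (Icc (0 : ℝ) 1 ×ˢ S ×ˢ convexHull ℝ T) := by
    ext x
    simp only [mem_convexJoin, segment_eq_image, mem_image, Prod.exists, mem_prod]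
    constructor
    · rintro ⟨a, ha, b, hb, t, ht, rfl⟩
      exact ⟨t, a, b, ⟨ht, ha, hb⟩, rfl⟩
    · rintro ⟨t, a, b, ⟨ht, ha, hb⟩, rfl⟩
      exact ⟨a, ha, b, hb, t, ht, rfl⟩
  rw [himg]
  exact (isCompact_Icc.prod (hS.prod (hT.isCompact_convexHull ℝ))).image (by fun_prop)

/-! ### Disks have the carousel property. -/

theorem planeForm_le_of_mem_closedBall {a b : ℝ} (hab : a ^ 2 + b ^ 2 = 1) {c x : Plane} {r : ℝ}
    (hx : x ∈ closedBall c r) : planeForm a b x ≤ planeForm a b c + r := by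
  have hr : 0 ≤ r := dist_nonneg.trans (mem_closedBall.1 hx)
  have h2 : dist x c ^ 2 ≤ r ^ 2 := by
    have := mem_closedBall.1 hx
    gcongr
  rw [plane_dist_sq] at h2
  have : a * (x 0 - c 0) + b * (x 1 - c 1) ≤ r := by
    apply le_of_sq_le_sq _ hr
    nlinarith [sq_nonneg (a * (x 1 - c 1) - b * (x 0 - c 0))]
  simp only [planeForm]
  linarith

theorem exists_mem_closedBall_planeForm_eq {a b : ℝ} (hab : a ^ 2 + b ^ 2 = 1) (c : Plane) {r : ℝ}
    (hr : 0 ≤ r) : ∃ x ∈ closedBall c r, planeForm a b x = planeForm a b c + r := by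
  refine ⟨c + r • !₂[a, b], ?_, ?_⟩
  · rw [mem_closedBall, ← sq_le_sq₀ dist_nonneg hr, plane_dist_sq]
    simp
    nlinarith
  · simp [planeForm]
    linear_combination r * hab

/-- Triangle inequality for unit vectors, obtained by expanding the squared norm. -/
theorem one_le_add_of_unit_comb {a₁ b₁ a₂ b₂ a b α β : ℝ}
    (h₁ : a₁ ^ 2 + b₁ ^ 2 = 1) (h₂ : a₂ ^ 2 + b₂ ^ 2 = 1) (h : a ^ 2 + b ^ 2 = 1)
    (hα : 0 ≤ α) (hβ : 0 ≤ β) (ha : a = α * a₁ + β * a₂) (hb : b = α * b₁ + β * b₂) :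
    1 ≤ α + β := by
  have hin : a₁ * a₂ + b₁ * b₂ ≤ 1 := by linarith [sq_nonneg (a₁ - a₂), sq_nonneg (b₁ - b₂)]
  have hsq : (1 : ℝ) = α ^ 2 + β ^ 2 + 2 * (α * β) * (a₁ * a₂ + b₁ * b₂) := by
    rw [← h, ha, hb]
    linear_combination α ^ 2 * h₁ + β ^ 2 * h₂
  have := mul_le_mul_of_nonneg_left hin (mul_nonneg hα hβ)
  have hle : (1 : ℝ) ≤ (α + β) ^ 2 := by linarith
  exact (one_le_sq_iff₀ (add_nonneg hα hβ)).1 hle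

/-- With d = μ(A - B) + ν(A - C), the unit directions at B and C both exceed s on d. The direction
at A is a nonnegative combination of these two with coefficient sum at least 1, so it is at least s
on d. If A equals B or C, the hypotheses on d are already contradictory. -/
theorem planeForm_comb_ge_of_normal_cones {A B C : Plane} {a₁ b₁ a₂ b₂ a b μ ν s : ℝ}
    (h₁ : a₁ ^ 2 + b₁ ^ 2 = 1) (h₂ : a₂ ^ 2 + b₂ ^ 2 = 1) (h : a ^ 2 + b ^ 2 = 1)
    (hμ : 0 < μ) (hν : 0 < ν) (hs : 0 ≤ s)
    (hBA : A ≠ B → planeForm a₁ b₁ A < planeForm a₁ b₁ B)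
    (hCA : A ≠ C → planeForm a₂ b₂ A < planeForm a₂ b₂ C)
    (hAB : B ≠ A → planeForm a b B < planeForm a b A)
    (hAC : C ≠ A → planeForm a b C < planeForm a b A)
    (hd₁ : s < μ * (planeForm a₁ b₁ A - planeForm a₁ b₁ B)
      + ν * (planeForm a₁ b₁ A - planeForm a₁ b₁ C))
    (hd₂ : s < μ * (planeForm a₂ b₂ A - planeForm a₂ b₂ B)
      + ν * (planeForm a₂ b₂ A - planeForm a₂ b₂ C)) :
    s ≤ μ * (planeForm a b A - planeForm a b B) + ν * (planeForm a b A - planeForm a b C) := by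
  rcases eq_or_ne A B with rfl | hne₁
  · rcases eq_or_ne A C with rfl | hne₂
    · simp at hd₁; linarith
    · have := hCA hne₂
      nlinarith
  rcases eq_or_ne A C with rfl | hne₂
  · have := hBA hne₁
    nlinarith
  replace hBA := hBA hne₁
  replace hCA := hCA hne₂
  replace hAB := hAB hne₁.symm
  replace hAC := hAC hne₂.symm
  simp only [planeForm] at *
  set p₀ := A 0 - B 0 with hp₀
  set p₁ := A 1 - B 1 with hp₁
  set q₀ := A 0 - C 0 with hq₀
  set q₁ := A 1 - C 1 with hq₁
  obtain ⟨x₁, hx₁⟩ : ∃ x, x = -(a₁ * p₀ + b₁ * p₁) := ⟨_, rfl⟩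
  obtain ⟨y₁, hy₁⟩ : ∃ x, x = a₁ * q₀ + b₁ * q₁ := ⟨_, rfl⟩
  obtain ⟨x₂, hx₂⟩ : ∃ x, x = a₂ * p₀ + b₂ * p₁ := ⟨_, rfl⟩
  obtain ⟨y₂, hy₂⟩ : ∃ x, x = -(a₂ * q₀ + b₂ * q₁) := ⟨_, rfl⟩
  obtain ⟨P, hP⟩ : ∃ x, x = a * p₀ + b * p₁ := ⟨_, rfl⟩
  obtain ⟨Q, hQ⟩ : ∃ x, x = a * q₀ + b * q₁ := ⟨_, rfl⟩
  have x₁p : 0 < x₁ := by linarith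
  have y₂p : 0 < y₂ := by linarith
  have Pp : 0 < P := by linarith
  have Qp : 0 < Q := by linarith
  have e₁ : s < ν * y₁ - μ * x₁ := by rw [hx₁, hy₁]; linarith
  have e₂ : s < μ * x₂ - ν * y₂ := by rw [hx₂, hy₂]; linarith
  have y₁p : 0 < y₁ := by
    have := mul_pos hμ x₁p
    exact pos_of_mul_pos_right (by linarith : 0 < ν * y₁) hν.le
  have x₂p : 0 < x₂ := by
    have := mul_pos hν y₂p
    exact pos_of_mul_pos_right (by linarith : 0 < μ * x₂) hμ.le
  have hΔ : 0 < x₂ * y₁ - x₁ * y₂ := by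
    have k₁ : μ * x₁ < ν * y₁ := by linarith
    have k₂ : ν * y₂ < μ * x₂ := by linarith
    have k₃ := mul_lt_mul'' k₁ k₂ (by positivity) (by positivity)
    have : 0 < (μ * ν) * (x₂ * y₁ - x₁ * y₂) := by linarith
    exact pos_of_mul_pos_right this (by positivity)
  obtain ⟨Δ, hΔe⟩ : ∃ x, x = x₂ * y₁ - x₁ * y₂ := ⟨_, rfl⟩
  rw [← hΔe] at hΔ
  -- Cramer's rule for the coefficients of (a, b) in terms of (a₁, b₁) and (a₂, b₂); the signs
  -- collected above make them nonnegative.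
  obtain ⟨α, hα⟩ : ∃ x, x = (y₂ * P + x₂ * Q) / Δ := ⟨_, rfl⟩
  obtain ⟨β, hβ⟩ : ∃ x, x = (y₁ * P + x₁ * Q) / Δ := ⟨_, rfl⟩
  have α0 : 0 ≤ α := by rw [hα]; positivity
  have β0 : 0 ≤ β := by rw [hβ]; positivity
  have hP' : P = -x₁ * α + x₂ * β := by
    rw [hα, hβ]; field_simp; rw [hΔe]; ring
  have hQ' : Q = y₁ * α - y₂ * β := by
    rw [hα, hβ]; field_simp; rw [hΔe]; ring
  have hdet : Δ = (a₁ * b₂ - b₁ * a₂) * (q₀ * p₁ - q₁ * p₀) := by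
    rw [hΔe, hx₁, hy₁, hx₂, hy₂]; ring
  have hne : q₀ * p₁ - q₁ * p₀ ≠ 0 := by
    intro h0
    rw [h0, mul_zero] at hdet
    exact hΔ.ne' hdet
  have r₁ : p₀ * (a - α * a₁ - β * a₂) + p₁ * (b - α * b₁ - β * b₂) = 0 := by
    rw [hP, hx₁, hx₂] at hP'; linarith
  have r₂ : q₀ * (a - α * a₁ - β * a₂) + q₁ * (b - α * b₁ - β * b₂) = 0 := by
    rw [hQ, hy₁, hy₂] at hQ'; linarith
  have ea : a - α * a₁ - β * a₂ = 0 := by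
    apply mul_left_cancel₀ hne
    linear_combination p₁ * r₂ - q₁ * r₁
  have eb : b - α * b₁ - β * b₂ = 0 := by
    apply mul_left_cancel₀ hne
    linear_combination q₀ * r₁ - p₀ * r₂
  have hab : 1 ≤ α + β := one_le_add_of_unit_comb h₁ h₂ h α0 β0 (by linarith) (by linarith)
  have hfin : s ≤ μ * P + ν * Q := by
    rw [hP', hQ']
    linarith [mul_le_mul_of_nonneg_left e₁.le α0, mul_le_mul_of_nonneg_left e₂.le β0,
      le_mul_of_one_le_left hs hab]
  calc s ≤ μ * P + ν * Q := hfin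
    _ = _ := by rw [hP, hQ, hp₀, hp₁, hq₀, hq₁]; ring

/-- Separate a point of the first disk from the hull. All vertices other than `A j` lie below that
point, yet it belongs to the triangle, so `A j` must reach its level. -/
theorem exists_planeForm_gt_of_closedBall_not_subset {c₀ c₁ : Plane} {r₀ r₁ : ℝ} (hr₁ : 0 ≤ r₁)
    {A : Fin 3 → Plane} (hA : closedBall c₀ r₀ ⊆ convexHull ℝ {A 0, A 1, A 2}) {j : Fin 3}
    (h : ¬ closedBall c₀ r₀ ⊆
      convexHull ℝ (closedBall c₁ r₁ ∪ (({A 0, A 1, A 2} : Set Plane) \ {A j}))) :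
    ∃ a b, a ^ 2 + b ^ 2 = 1 ∧ planeForm a b c₁ + r₁ < planeForm a b c₀ + r₀ ∧
      ∀ i, A i ≠ A j → planeForm a b (A i) < planeForm a b (A j) := by
  obtain ⟨x, hx, hxn⟩ := not_subset.1 h
  have hfin : (({A 0, A 1, A 2} : Set Plane) \ {A j}).Finite := (toFinite _).sdiff
  have hcl := (isCompact_convexHull_union (isCompact_closedBall c₁ r₁) (convex_closedBall c₁ r₁)
    hfin).isClosed
  obtain ⟨a, b, hab, hlt⟩ := exists_unit_planeForm_lt
    ⟨c₁, subset_convexHull ℝ _ (Or.inl (mem_closedBall_self hr₁))⟩ (convex_convexHull ℝ _) hcl hxn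
  refine ⟨a, b, hab, ?_, fun i hi => ?_⟩
  · obtain ⟨y, hy, hye⟩ := exists_mem_closedBall_planeForm_eq hab c₁ hr₁
    rw [← hye]
    exact (hlt y (subset_convexHull ℝ _ (Or.inl hy))).trans_le
      (planeForm_le_of_mem_closedBall hab hx)
  · have hmem : ∀ k, A k ∈ ({A 0, A 1, A 2} : Set Plane) := by
      intro k; fin_cases k <;> simp
    have hlt' : ∀ k, A k ≠ A j → planeForm a b (A k) < planeForm a b x := fun k hk =>
      hlt _ (subset_convexHull ℝ _ (Or.inr ⟨hmem k, hk⟩))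
    refine (hlt' i hi).trans_le ?_
    by_contra! hj
    have hall : ∀ k, planeForm a b (A k) < planeForm a b x := fun k => by
      by_cases hk : A k = A j
      · rwa [hk]
      · exact hlt' k hk
    refine lt_irrefl (planeForm a b x) (planeForm_lt_of_mem_convexHull ?_ (hA hx))
    rintro y (rfl | rfl | rfl) <;> exact hall _

/-- Signs of the weights are dropped: only differences of two weight systems are used. -/
theorem exists_weights_of_mem_convexHull {A : Fin 3 → Plane} {x : Plane}
    (hx : x ∈ convexHull ℝ {A 0, A 1, A 2}) :
    ∃ w : Fin 3 → ℝ, w 0 + w 1 + w 2 = 1 ∧ ∀ a b, planeForm a b x =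
      w 0 * planeForm a b (A 0) + w 1 * planeForm a b (A 1) + w 2 * planeForm a b (A 2) := by
  rw [convexHull_insert (by simp), convexHull_pair] at hx
  simp only [mem_convexJoin, mem_singleton_iff, exists_eq_left] at hx
  obtain ⟨y, ⟨s, t, -, -, hst, rfl⟩, ⟨p, q, -, -, hpq, rfl⟩⟩ := hx
  refine ⟨![p, q * s, q * t], ?_, fun a b => ?_⟩
  · simp
    linear_combination hpq + q * hst
  · rw [planeForm_convex_comb, planeForm_convex_comb]
    simp
    ring

theorem closedBall_carousel_of_le {c₀ c₁ : Plane} {r₀ r₁ : ℝ} (hr₀ : 0 ≤ r₀) (hr : r₀ ≤ r₁)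
    {A : Fin 3 → Plane} (hA₀ : closedBall c₀ r₀ ⊆ convexHull ℝ {A 0, A 1, A 2})
    (hA₁ : closedBall c₁ r₁ ⊆ convexHull ℝ {A 0, A 1, A 2}) :
    (∃ j, closedBall c₀ r₀ ⊆
      convexHull ℝ (closedBall c₁ r₁ ∪ (({A 0, A 1, A 2} : Set Plane) \ {A j}))) ∨
    ∃ j, closedBall c₁ r₁ ⊆
      convexHull ℝ (closedBall c₀ r₀ ∪ (({A 0, A 1, A 2} : Set Plane) \ {A j})) := by
  have hr₁ := hr₀.trans hr
  by_contra! hcon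
  obtain ⟨h₀, h₁⟩ := hcon
  choose a b hab hu htop using
    fun j => exists_planeForm_gt_of_closedBall_not_subset hr₁ hA₀ (h₀ j)
  choose a' b' hab' hv htop' using
    fun j => exists_planeForm_gt_of_closedBall_not_subset hr₀ hA₁ (h₁ j)
  obtain ⟨w, hw, hwe⟩ := exists_weights_of_mem_convexHull (hA₀ (mem_closedBall_self hr₀))
  obtain ⟨w', hw', hwe'⟩ := exists_weights_of_mem_convexHull (hA₁ (mem_closedBall_self hr₁))
  obtain ⟨l, hl⟩ : ∃ l : Fin 3 → ℝ, ∀ i, l i = w i - w' i := ⟨_, fun _ => rfl⟩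
  have hl0 : l 0 + l 1 + l 2 = 0 := by rw [hl, hl, hl]; linarith
  have hd : ∀ a b, planeForm a b c₀ - planeForm a b c₁ =
      l 0 * planeForm a b (A 0) + l 1 * planeForm a b (A 1) + l 2 * planeForm a b (A 2) := by
    intro a b
    rw [hwe, hwe', hl, hl, hl]; ring
  have hle : ∀ i j, planeForm (a j) (b j) (A i) ≤ planeForm (a j) (b j) (A j) := fun i j => by
    by_cases h : A i = A j
    · rw [h]
    · exact (htop j i h).le
  -- The weights cannot be negative at two vertices at once.
  have key : ∀ i j k, l i + l j + l k = 0 → (∀ a b, planeForm a b c₀ - planeForm a b c₁ =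
      l i * planeForm a b (A i) + l j * planeForm a b (A j) + l k * planeForm a b (A k)) →
      l j < 0 → l k < 0 → False := by
    intro i j k hs hdd hj hk
    have hdd' : ∀ a b, planeForm a b c₀ - planeForm a b c₁ =
        -l j * (planeForm a b (A i) - planeForm a b (A j))
        + -l k * (planeForm a b (A i) - planeForm a b (A k)) := by
      intro a b
      rw [hdd]
      linear_combination planeForm a b (A i) * hs
    have := planeForm_comb_ge_of_normal_cones (A := A i) (B := A j) (C := A k) (hab j) (hab k)
      (hab' i) (neg_pos.2 hj) (neg_pos.2 hk) (sub_nonneg.2 hr) (htop j i) (htop k i) (htop' i j)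
      (htop' i k) (by rw [← hdd']; linarith [hu j]) (by rw [← hdd']; linarith [hu k])
    rw [← hdd'] at this
    linarith [hv i]
  -- Two nonnegative weights make c₀ - c₁ nonpositive in the direction `(a i, b i)`, where it must
  -- exceed r₁ - r₀ ≥ 0.
  have key' : ∀ i j k, l i + l j + l k = 0 → (∀ a b, planeForm a b c₀ - planeForm a b c₁ =
      l i * planeForm a b (A i) + l j * planeForm a b (A j) + l k * planeForm a b (A k)) →
      0 ≤ l j → 0 ≤ l k → False := by
    intro i j k hs hdd hj hk
    have e := hdd (a i) (b i)
    have hli : l i = -(l j + l k) := by linarith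
    rw [hli] at e
    have := mul_le_mul_of_nonneg_left (hle j i) hj
    have := mul_le_mul_of_nonneg_left (hle k i) hk
    linarith [hu i]
  have s₁ : l 1 + l 0 + l 2 = 0 := by linarith
  have s₂ : l 2 + l 0 + l 1 = 0 := by linarith
  have d₁ : ∀ a b, planeForm a b c₀ - planeForm a b c₁ =
      l 1 * planeForm a b (A 1) + l 0 * planeForm a b (A 0) + l 2 * planeForm a b (A 2) :=
    fun a b => by rw [hd]; ring
  have d₂ : ∀ a b, planeForm a b c₀ - planeForm a b c₁ =
      l 2 * planeForm a b (A 2) + l 0 * planeForm a b (A 0) + l 1 * planeForm a b (A 1) :=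
    fun a b => by rw [hd]; ring
  rcases lt_or_ge (l 0) 0 with n0 | n0 <;> rcases lt_or_ge (l 1) 0 with n1 | n1 <;>
    rcases lt_or_ge (l 2) 0 with n2 | n2
  all_goals first
    | exact key 0 1 2 hl0 hd n1 n2
    | exact key 1 0 2 s₁ d₁ n0 n2
    | exact key 2 0 1 s₂ d₂ n0 n1
    | exact key' 0 1 2 hl0 hd n1 n2
    | exact key' 1 0 2 s₁ d₁ n0 n2
    | exact key' 2 0 1 s₂ d₂ n0 n1

theorem IsDisk.weakCarousel_similarSets {K : Set Plane} (hK : IsDisk K) :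
    WeakCarousel SimilarSets K := by
  obtain ⟨c, r, hr, rfl⟩ := hK
  rintro K₁ A ⟨φ, rfl⟩ h₀ h₁
  have himg : φ '' closedBall c r = closedBall (φ c) (Dilation.ratio φ * r) := by
    ext x
    simp only [mem_image, mem_closedBall]
    have hpos : (0 : ℝ) < Dilation.ratio φ := by exact_mod_cast Dilation.ratio_pos φ
    constructor
    · rintro ⟨y, hy, rfl⟩
      rw [Dilation.dist_eq]
      gcongr
    · intro hx
      refine ⟨φ.symm x, ?_, φ.apply_symm_apply x⟩
      rw [← φ.apply_symm_apply x, Dilation.dist_eq] at hx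
      exact le_of_mul_le_mul_left hx hpos
  have hr' : 0 ≤ Dilation.ratio φ * r := by positivity
  rw [himg] at h₁ ⊢
  rcases le_total r (Dilation.ratio φ * r) with hle | hle
  · rcases closedBall_carousel_of_le hr hle h₀ h₁ with ⟨j, hj⟩ | ⟨j, hj⟩
    · exact ⟨j, 1, by simpa using hj⟩
    · exact ⟨j, 0, by simpa using hj⟩
  · rcases closedBall_carousel_of_le hr' hle h₁ h₀ with ⟨j, hj⟩ | ⟨j, hj⟩
    · exact ⟨j, 0, by simpa using hj⟩
    · exact ⟨j, 1, by simpa using hj⟩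

theorem WeakCarousel.isometricSets {K : Set Plane} (hK : WeakCarousel SimilarSets K) :
    WeakCarousel IsometricSets K := by
  rintro K₁ A ⟨φ, rfl⟩ h₀ h₁
  exact hK _ A ⟨φ.toDilationEquiv, by simp⟩ h₀ h₁

/-! ### Support functions and their behavior under isometries. -/

/-- The support function of a planar set, as a function of the coordinates of the direction. -/
noncomputable def supportValue (K : Set Plane) (a b : ℝ) : ℝ := sSup (planeForm a b '' K)

theorem planeForm_le_supportValue {K : Set Plane} (hK : IsCompact K) (a b : ℝ) {x : Plane}
    (hx : x ∈ K) : planeForm a b x ≤ supportValue K a b :=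
  le_csSup (hK.image (continuous_planeForm a b)).bddAbove (mem_image_of_mem _ hx)

theorem exists_planeForm_eq_supportValue {K : Set Plane} (hK : IsCompact K) (hne : K.Nonempty)
    (a b : ℝ) : ∃ x ∈ K, planeForm a b x = supportValue K a b := by
  obtain ⟨x, hx, h⟩ := hK.exists_sSup_image_eq hne (continuous_planeForm a b).continuousOn
  exact ⟨x, hx, h.symm⟩

theorem supportValue_le {K : Set Plane} (hne : K.Nonempty) {a b r : ℝ}
    (h : ∀ x ∈ K, planeForm a b x ≤ r) : supportValue K a b ≤ r :=
  csSup_le (hne.image _) (by rintro _ ⟨x, hx, rfl⟩; exact h x hx)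

theorem continuous_supportValue {K : Set Plane} (hK : IsCompact K) :
    Continuous fun v : ℝ × ℝ => supportValue K v.1 v.2 := by
  refine hK.continuous_sSup (f := fun (v : ℝ × ℝ) x => planeForm v.1 v.2 x) ?_
  simp only [planeForm, Function.HasUncurry.uncurry, id]
  fun_prop

theorem Continuous.supportValue {K : Set Plane} (hK : IsCompact K) {X : Type*} [TopologicalSpace X]
    {f g : X → ℝ} (hf : Continuous f) (hg : Continuous g) :
    Continuous fun x => supportValue K (f x) (g x) :=
  (continuous_supportValue hK).comp (hf.prodMk hg)

/-- The isometry of the plane with linear part `(x, y) ↦ (c x - s ε y, s x + c ε y)` and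
translation part `(t₁, t₂)`. -/
noncomputable def planeIsometry (c s ε t₁ t₂ : ℝ) (h : c ^ 2 + s ^ 2 = 1) (hε : ε ^ 2 = 1) :
    Plane ≃ᵢ Plane :=
  IsometryEquiv.mk' (fun x => !₂[c * x 0 - s * ε * x 1 + t₁, s * x 0 + c * ε * x 1 + t₂])
    (fun y => !₂[c * (y 0 - t₁) + s * (y 1 - t₂), ε * (-s * (y 0 - t₁) + c * (y 1 - t₂))])
    (fun y => by
      apply plane_ext
      · simp
        linear_combination (y 0 - t₁) * h + (y 0 - t₁) * s ^ 2 * hε - s * c * (y 1 - t₂) * hε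
      · simp
        linear_combination (y 1 - t₂) * h + (y 1 - t₂) * c ^ 2 * hε - s * c * (y 0 - t₁) * hε)
    (Isometry.of_dist_eq fun x y => by
      rw [← sq_eq_sq₀ dist_nonneg dist_nonneg, plane_dist_sq, plane_dist_sq]
      simp
      linear_combination ((x 0 - y 0) ^ 2 + ε ^ 2 * (x 1 - y 1) ^ 2) * h + (x 1 - y 1) ^ 2 * hε)

theorem planeIsometry_apply {c s ε t₁ t₂ : ℝ} (h : c ^ 2 + s ^ 2 = 1) (hε : ε ^ 2 = 1)
    (x : Plane) : planeIsometry c s ε t₁ t₂ h hε x =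
      !₂[c * x 0 - s * ε * x 1 + t₁, s * x 0 + c * ε * x 1 + t₂] := rfl

theorem planeForm_planeIsometry {c s ε t₁ t₂ : ℝ} (h : c ^ 2 + s ^ 2 = 1) (hε : ε ^ 2 = 1)
    (a b : ℝ) (x : Plane) : planeForm a b (planeIsometry c s ε t₁ t₂ h hε x) =
      planeForm (a * c + b * s) (ε * (b * c - a * s)) x + (a * t₁ + b * t₂) := by
  simp [planeForm, planeIsometry_apply]
  ring

theorem supportValue_planeIsometry_image {K : Set Plane} (hK : IsCompact K) (hne : K.Nonempty)
    {c s ε t₁ t₂ : ℝ} (h : c ^ 2 + s ^ 2 = 1) (hε : ε ^ 2 = 1) (a b : ℝ) :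
    supportValue (planeIsometry c s ε t₁ t₂ h hε '' K) a b =
      supportValue K (a * c + b * s) (ε * (b * c - a * s)) + (a * t₁ + b * t₂) := by
  apply le_antisymm
  · apply supportValue_le (hne.image _)
    rintro _ ⟨x, hx, rfl⟩
    rw [planeForm_planeIsometry]
    gcongr
    exact planeForm_le_supportValue hK _ _ hx
  · obtain ⟨x, hx, hxe⟩ := exists_planeForm_eq_supportValue hK hne
      (a * c + b * s) (ε * (b * c - a * s))
    rw [← hxe, ← planeForm_planeIsometry h hε]
    exact planeForm_le_supportValue
      (hK.image (planeIsometry c s ε t₁ t₂ h hε).continuous) _ _ (mem_image_of_mem _ hx)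

theorem image_subset_convexHull_image (φ : Plane ≃ᵢ Plane) {S T : Set Plane}
    (h : S ⊆ convexHull ℝ T) : φ '' S ⊆ convexHull ℝ (φ '' T) := by
  have := (φ.toRealAffineIsometryEquiv.toAffineEquiv : Plane →ᵃ[ℝ] Plane).image_convexHull T
  have hco : ⇑(φ.toRealAffineIsometryEquiv.toAffineEquiv : Plane →ᵃ[ℝ] Plane) = φ :=
    φ.coeFn_toRealAffineIsometryEquiv
  rw [hco] at this
  rw [← this]
  exact image_mono h

/-- Conjugation by φ transports the property, so K may be translated, rotated and reflected freely.
-/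
theorem WeakCarousel.image {K : Set Plane} (hK : WeakCarousel IsometricSets K)
    (φ : Plane ≃ᵢ Plane) : WeakCarousel IsometricSets (φ '' K) := by
  rintro _ A ⟨ψ, rfl⟩ h₀ h₁
  have hs : ∀ S : Set Plane, φ.symm '' (φ '' S) = S := fun S => by
    rw [← image_comp]; simp
  have hs' : ∀ S : Set Plane, φ '' (φ.symm '' S) = S := fun S => by
    rw [← image_comp]; simp
  have himg : φ.symm '' {A 0, A 1, A 2} = {φ.symm (A 0), φ.symm (A 1), φ.symm (A 2)} := by
    simp [image_insert_eq]
  have himg' : ∀ j, φ '' (({φ.symm (A 0), φ.symm (A 1), φ.symm (A 2)} : Set Plane)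
      \ {φ.symm (A j)}) = ({A 0, A 1, A 2} : Set Plane) \ {A j} := fun j => by
    rw [image_sdiff φ.injective]
    simp [image_insert_eq]
  have k₀ := image_subset_convexHull_image φ.symm h₀
  have k₁ := image_subset_convexHull_image φ.symm h₁
  rw [himg] at k₀ k₁
  rw [hs] at k₀
  obtain ⟨j, k, h⟩ := hK (φ.symm '' (ψ '' (φ '' K))) (fun i => φ.symm (A i))
    ⟨(φ.trans ψ).trans φ.symm, by simp only [image_image]; rfl⟩ k₀ k₁
  have h' := image_subset_convexHull_image φ h
  rw [image_union, himg'] at h'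
  refine ⟨j, k, ?_⟩
  fin_cases k <;> simpa [hs'] using h'

/-! ### The isosceles triangle around K and its mirror image. -/

theorem mem_convexHull_isosceles {p q m H : ℝ} (hp : 0 < p) (hq : 0 < q) (hH : 0 < H) {x : Plane}
    (h₁ : x 0 ≤ m) (h₂ : -p * x 0 + q * x 1 ≤ q * H - p * m)
    (h₃ : -p * x 0 - q * x 1 ≤ q * H - p * m) :
    x ∈ convexHull ℝ {!₂[m, H], !₂[m - q * H / p, 0], (!₂[m, -H] : Plane)} := by
  refine mem_convexHull_of_exists_fintype
    -- Barycentric coordinates: the slack in each side's inequality, divided by its value at the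
    -- opposite vertex.
    (w := ![(q * H - p * m + p * x 0 + q * x 1) / (2 * (q * H)), p * (m - x 0) / (q * H),
      (q * H - p * m + p * x 0 - q * x 1) / (2 * (q * H))])
    (z := ![!₂[m, H], !₂[m - q * H / p, 0], (!₂[m, -H] : Plane)]) ?_ ?_ ?_ ?_
  · intro i
    fin_cases i
    · exact div_nonneg (by linarith) (by positivity)
    · exact div_nonneg (mul_nonneg hp.le (by linarith)) (by positivity)
    · exact div_nonneg (by linarith) (by positivity)
  · simp [Fin.sum_univ_three]
    field_simp
    ring
  · intro i
    fin_cases i <;> simp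
  · apply plane_ext
    · simp [Fin.sum_univ_three]
      field_simp
      ring
    · simp [Fin.sum_univ_three]
      field_simp
      ring

theorem not_subset_convexHull_of_planeForm_lt {S T : Set Plane} {A : Fin 3 → Plane} {j : Fin 3}
    {a b : ℝ} {x : Plane} (hx : x ∈ S) (hT : ∀ y ∈ T, planeForm a b y < planeForm a b x)
    (hA : ∀ i, i ≠ j → planeForm a b (A i) < planeForm a b x) :
    ¬ S ⊆ convexHull ℝ (T ∪ (({A 0, A 1, A 2} : Set Plane) \ {A j})) := by
  intro h
  refine lt_irrefl (planeForm a b x) (planeForm_lt_of_mem_convexHull ?_ (h hx))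
  have hij : ∀ i, A i ≠ A j → planeForm a b (A i) < planeForm a b x :=
    fun i hi => hA i fun e => hi (by rw [e])
  rintro y (hy | ⟨rfl | rfl | rfl, hy⟩)
  · exact hT y hy
  all_goals exact hij _ hy

/-- For each j, a direction in which K overtakes its mirror image and the two vertices other than
the j-th. It is a slight tilt of a side's outer normal: (1, θ) for the upper vertex, (-p, -q + δ)
for the left apex, (-p, -q - δ) for the lower vertex. -/
theorem exists_directions_isosceles {K : Set Plane} (hK : IsCompact K) (hne : K.Nonempty)
    {p q H : ℝ} (hp : 0 < p) (hq : 0 < q) (hH : 0 < H)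
    (hn : supportValue K (-p) (-q) = q * H - p * supportValue K 1 0)
    (hlt : supportValue K (-p) q < supportValue K (-p) (-q))
    (hfr : ∃ᶠ θ in 𝓝[>] (0 : ℝ), supportValue K 1 (-θ) < supportValue K 1 θ) (j : Fin 3) :
    ∃ a b, supportValue K a (-b) < supportValue K a b ∧ ∀ i, i ≠ j →
      planeForm a b ((![!₂[supportValue K 1 0, H], !₂[supportValue K 1 0 - q * H / p, 0],
        !₂[supportValue K 1 0, -H]] : Fin 3 → Plane) i) < supportValue K a b := by
  obtain ⟨x, hx, hxe⟩ := exists_planeForm_eq_supportValue hK hne 1 0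
  obtain ⟨y, hy, hye⟩ := exists_planeForm_eq_supportValue hK hne (-p) (-q)
  have hle := fun a b {z : Plane} (hz : z ∈ K) => planeForm_le_supportValue hK a b hz
  set m := supportValue K 1 0 with hm
  have hpos : ∀ᶠ δ in 𝓝[>] (0 : ℝ), 0 < δ := eventually_mem_nhdsWithin
  have hev : ∀ {f g : ℝ → ℝ}, Continuous f → Continuous g → f 0 < g 0 →
      ∀ᶠ δ in 𝓝[>] (0 : ℝ), f δ < g δ := fun hf hg h =>
    (hf.continuousAt.eventually_lt hg.continuousAt h).filter_mono nhdsWithin_le_nhds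
  have hw : ∀ z ∈ K, z 0 ≤ m ∧ -p * z 0 - q * z 1 ≤ q * H - p * m ∧
      -p * z 0 + q * z 1 < q * H - p * m := fun z hz => by
    have i₁ := hle 1 0 hz
    have i₂ := hle (-p) (-q) hz
    have i₃ := (hle (-p) q hz).trans_lt hlt
    simp only [planeForm] at i₁ i₂ i₃
    exact ⟨by linarith, by linarith, by linarith⟩
  have hqH : 0 < q * H := mul_pos hq hH
  simp only [planeForm] at hxe hye hle
  -- The vertex `(m, -H)` does not belong to `K`.
  have hcorner : ∀ z ∈ K, ¬ (z 0 = m ∧ z 1 = -H) := by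
    rintro z hz ⟨h0, h1⟩
    -- At that corner K would attain the maximum of (1, -θ) over the triangle, which equals the
    -- maximum of (1, θ), against `hfr`.
    obtain ⟨θ, hθ, hθ0⟩ := (hfr.and_eventually hpos).exists
    refine absurd hθ (not_lt.2 ?_)
    apply supportValue_le hne
    intro w hwK
    have i₁ := hle 1 (-θ) hz
    obtain ⟨j₁, j₂, j₃⟩ := hw w hwK
    refine le_trans ?_ i₁
    rw [h0, h1]
    simp only [planeForm]
    have i₂ : q * w 1 ≤ q * H - p * m + p * w 0 := by linarith
    have i₃ : p * w 0 ≤ p * m := by gcongr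
    have i₄ : w 1 ≤ H := le_of_mul_le_mul_left (by linarith) hq
    have i₅ : θ * w 1 ≤ θ * H := by gcongr
    linarith
  have hx1 : -H < x 1 := by
    obtain ⟨j₁, j₂, j₃⟩ := hw x hx
    have hx0 : x 0 = m := by linarith
    rw [hx0] at j₂
    have h : -H ≤ x 1 := le_of_mul_le_mul_left (by linarith) hq
    exact lt_of_le_of_ne h fun e => hcorner x hx ⟨hx0, e.symm⟩
  have hy1 : -H < y 1 := by
    obtain ⟨j₁, j₂, j₃⟩ := hw y hy
    have i₃ : p * y 0 ≤ p * m := by gcongr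
    have h : -H ≤ y 1 := le_of_mul_le_mul_left (by linarith) hq
    refine lt_of_le_of_ne h fun e => hcorner y hy ⟨?_, e.symm⟩
    rw [← e] at hye
    exact mul_left_cancel₀ hp.ne' (by linarith)
  -- `y` touches the lower slanted side, while all of K stays strictly off the upper one.
  have hy0 : y 1 < 0 := by
    obtain ⟨j₁, j₂, j₃⟩ := hw y hy
    by_contra! h
    have := mul_nonneg hq.le h
    linarith
  have cK := @Continuous.supportValue K hK ℝ _
  fin_cases j
  · have e₁ := hev (f := fun θ => 1 * (m - q * H / p) + θ * 0) (g := fun θ => supportValue K 1 θ)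
      (by fun_prop) (cK continuous_const continuous_id) (by
        have : 0 < q * H / p := by positivity
        rw [← hm]; linarith)
    obtain ⟨θ, hθ, hθ1, hθ0⟩ := (hfr.and_eventually (e₁.and hpos)).exists
    refine ⟨1, θ, hθ, fun i hi => ?_⟩
    fin_cases i
    · simp at hi
    · simpa [planeForm] using hθ1
    · have := hle 1 θ hx
      have := mul_lt_mul_of_pos_left hx1 hθ0
      simp [planeForm]
      linarith
  · have e₁ := hev (f := fun δ => supportValue K (-p) (-(-q + δ)))
      (g := fun δ => supportValue K (-p) (-q + δ))
      (cK continuous_const (by fun_prop)) (cK continuous_const (by fun_prop)) (by simpa using hlt)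
    have e₂ := hev (f := fun δ => -p * m + (-q + δ) * H) (g := fun δ => supportValue K (-p) (-q + δ))
      (by fun_prop) (cK continuous_const (by fun_prop)) (by
        simp only [add_zero, hn]; linarith)
    obtain ⟨δ, hδ1, hδ2, hδ0⟩ := (e₁.and (e₂.and hpos)).exists
    refine ⟨-p, -q + δ, hδ1, fun i hi => ?_⟩
    fin_cases i
    · simpa [planeForm] using hδ2
    · simp at hi
    · have := hle (-p) (-q + δ) hy
      have := mul_lt_mul_of_pos_left hy1 hδ0
      simp [planeForm]
      linarith
  · have e₁ := hev (f := fun δ => supportValue K (-p) (-(-q - δ)))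
      (g := fun δ => supportValue K (-p) (-q - δ))
      (cK continuous_const (by fun_prop)) (cK continuous_const (by fun_prop)) (by simpa using hlt)
    have e₂ := hev (f := fun δ => -p * m + (-q - δ) * H) (g := fun δ => supportValue K (-p) (-q - δ))
      (by fun_prop) (cK continuous_const (by fun_prop)) (by
        simp only [sub_zero, hn]; linarith)
    obtain ⟨δ, hδ1, hδ2, hδ0⟩ := (e₁.and (e₂.and hpos)).exists
    refine ⟨-p, -q - δ, hδ1, fun i hi => ?_⟩
    fin_cases i
    · simpa [planeForm] using hδ2
    · have := hle (-p) (-q - δ) hy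
      have := mul_lt_mul_of_pos_left hy0 hδ0
      have : p * (q * H / p) = q * H := by field_simp
      simp [planeForm]
      linarith
    · simp at hi

/-- Otherwise K overtakes its mirror image near every vertex, and by symmetry the image overtakes K,
so no inclusion in the carousel conclusion holds. -/
theorem WeakCarousel.eventually_supportValue_le {K : Set Plane} (hK : IsCompact K)
    (hne : K.Nonempty) (hW : WeakCarousel IsometricSets K) {p q : ℝ} (hp : 0 < p) (hq : 0 < q)
    (hlt : supportValue K (-p) q < supportValue K (-p) (-q)) :
    ∀ᶠ θ in 𝓝[>] (0 : ℝ), supportValue K 1 θ ≤ supportValue K 1 (-θ) := by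
  by_contra hcon
  have hfr : ∃ᶠ θ in 𝓝[>] (0 : ℝ), supportValue K 1 (-θ) < supportValue K 1 θ := by
    simpa only [not_le] using Filter.not_eventually.1 hcon
  -- Chosen so that the support line of K with normal (-p, -q) passes through the corner (m, -H),
  -- where m is `supportValue K 1 0`.
  obtain ⟨H, hHe⟩ : ∃ H, H = (supportValue K (-p) (-q) + p * supportValue K 1 0) / q := ⟨_, rfl⟩
  have hn : supportValue K (-p) (-q) = q * H - p * supportValue K 1 0 := by
    rw [hHe]; field_simp; ring
  have hle := fun a b {z : Plane} (hz : z ∈ K) => planeForm_le_supportValue hK a b hz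
  have hH : 0 < H := by
    obtain ⟨z, hz⟩ := hne
    have i₁ := mul_le_mul_of_nonneg_left (hle 1 0 hz) hp.le
    have i₂ := hle (-p) (-q) hz
    have i₃ := hle (-p) q hz
    simp only [planeForm] at i₁ i₂ i₃
    exact pos_of_mul_pos_right (by linarith : 0 < q * H) hq.le
  have core := exists_directions_isosceles hK hne hp hq hH hn hlt hfr
  set m := supportValue K 1 0 with hm
  set A : Fin 3 → Plane := ![!₂[m, H], !₂[m - q * H / p, 0], !₂[m, -H]] with hA
  obtain ⟨σ, hσ⟩ : ∃ σ, σ = planeIsometry 1 0 (-1) 0 0 (by norm_num) (by norm_num) := ⟨_, rfl⟩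
  have hσf : ∀ a b z, planeForm a b (σ z) = planeForm a (-b) z := fun a b z => by
    rw [hσ, planeForm_planeIsometry]; simp
  have hσ0 : ∀ z, (σ z) 0 = z 0 := fun z => by rw [hσ, planeIsometry_apply]; simp
  have hσ1 : ∀ z, (σ z) 1 = -z 1 := fun z => by rw [hσ, planeIsometry_apply]; simp
  have hin : ∀ z ∈ K, z 0 ≤ m ∧ -p * z 0 + q * z 1 ≤ q * H - p * m ∧
      -p * z 0 - q * z 1 ≤ q * H - p * m := fun z hz => by
    have i₁ := hle 1 0 hz
    have i₂ := hle (-p) (-q) hz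
    have i₃ := (hle (-p) q hz).trans_lt hlt
    simp only [planeForm] at i₁ i₂ i₃
    exact ⟨by linarith, by linarith, by linarith⟩
  have h₀ : K ⊆ convexHull ℝ {A 0, A 1, A 2} := fun z hz => by
    obtain ⟨i₁, i₂, i₃⟩ := hin z hz
    exact mem_convexHull_isosceles hp hq hH i₁ i₂ i₃
  have h₁ : σ '' K ⊆ convexHull ℝ {A 0, A 1, A 2} := by
    rintro _ ⟨z, hz, rfl⟩
    obtain ⟨i₁, i₂, i₃⟩ := hin z hz
    exact mem_convexHull_isosceles hp hq hH (by rw [hσ0]; exact i₁)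
      (by rw [hσ0, hσ1]; linarith) (by rw [hσ0, hσ1]; linarith)
  obtain ⟨j, k, h⟩ := hW _ A ⟨σ, rfl⟩ h₀ h₁
  fin_cases k
  -- The reflection swaps the upper and lower vertices, so the directions found for K serve its
  -- image after `ρ`.
  · obtain ⟨ρ, hρ⟩ : ∃ ρ : Fin 3 → Fin 3, ρ = ![2, 1, 0] := ⟨_, rfl⟩
    have hρinj : ∀ i j, i ≠ j → ρ i ≠ ρ j := by rw [hρ]; decide
    have hρA : ∀ i a b, planeForm a (-b) (A i) = planeForm a b (A (ρ i)) := fun i a b => by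
      fin_cases i <;> simp [hρ, hA, planeForm]
    obtain ⟨a, b, hab, hi⟩ := core (ρ j)
    obtain ⟨x, hx, hxe⟩ := exists_planeForm_eq_supportValue hK hne a b
    refine not_subset_convexHull_of_planeForm_lt (S := σ '' K) (T := K) (a := a) (b := -b)
      (mem_image_of_mem σ hx) ?_ ?_ h
    · intro y hy
      rw [hσf, neg_neg, hxe]
      exact (hle _ _ hy).trans_lt hab
    · intro i hij
      rw [hσf, neg_neg, hxe, hρA]
      exact hi _ (hρinj _ _ hij)
  · obtain ⟨a, b, hab, hi⟩ := core j
    obtain ⟨x, hx, hxe⟩ := exists_planeForm_eq_supportValue hK hne a b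
    refine not_subset_convexHull_of_planeForm_lt (S := K) (T := σ '' K) (a := a) (b := b)
      hx ?_ ?_ h
    · rintro _ ⟨y, hy, rfl⟩
      rw [hσf, hxe]
      exact (hle _ _ hy).trans_lt hab
    · intro i hij
      rw [hxe]
      exact hi i hij

/-! ### From one-sided comparisons to a symmetry axis. -/

/-- A vertical translation by t adds 2t to every such quotient. If two quotients were separated by s
< s', suitable translates would force h(1, θ) - h(1, -θ) to be both ≤ sθ and ≥ s'θ for small θ > 0.
-/
theorem WeakCarousel.supportValue_slope_le {K : Set Plane} (hK : IsCompact K) (hne : K.Nonempty)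
    (hW : WeakCarousel IsometricSets K) {p q p' q' : ℝ} (hp : 0 < p) (hq : 0 < q) (hp' : 0 < p')
    (hq' : 0 < q') :
    (supportValue K (-p) q - supportValue K (-p) (-q)) / q ≤
      (supportValue K (-p') q' - supportValue K (-p') (-q')) / q' := by
  by_contra! hlt
  obtain ⟨s, hs, hsq⟩ := exists_between hlt
  obtain ⟨s', hs', hsq'⟩ := exists_between hsq
  rw [div_lt_iff₀ hq'] at hs
  rw [lt_div_iff₀ hq] at hsq'
  have up : ∀ᶠ θ in 𝓝[>] (0 : ℝ), supportValue K 1 θ - supportValue K 1 (-θ) ≤ s * θ := by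
    have := WeakCarousel.eventually_supportValue_le (hK.image
      (planeIsometry 1 0 1 0 (-s / 2) (by norm_num) (by norm_num)).continuous) (hne.image _)
      (hW.image _) hp' hq' (by
        rw [supportValue_planeIsometry_image hK hne, supportValue_planeIsometry_image hK hne]
        ring_nf at hs ⊢
        linarith)
    filter_upwards [this] with θ hθ
    rw [supportValue_planeIsometry_image hK hne, supportValue_planeIsometry_image hK hne] at hθ
    ring_nf at hθ ⊢
    linarith
  have low : ∀ᶠ θ in 𝓝[>] (0 : ℝ), s' * θ ≤ supportValue K 1 θ - supportValue K 1 (-θ) := by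
    -- Reflecting in the horizontal axis before translating reverses the inequality.
    have := WeakCarousel.eventually_supportValue_le (hK.image
      (planeIsometry 1 0 (-1) 0 (s' / 2) (by norm_num) (by norm_num)).continuous) (hne.image _)
      (hW.image _) hp hq (by
        rw [supportValue_planeIsometry_image hK hne, supportValue_planeIsometry_image hK hne]
        ring_nf at hsq' ⊢
        linarith)
    filter_upwards [this] with θ hθ
    rw [supportValue_planeIsometry_image hK hne, supportValue_planeIsometry_image hK hne] at hθ
    ring_nf at hθ ⊢
    linarith
  have hpos : ∀ᶠ δ in 𝓝[>] (0 : ℝ), 0 < δ := eventually_mem_nhdsWithin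
  obtain ⟨θ, hθ, hθ', hθ0⟩ := (up.and (low.and hpos)).exists
  have := mul_lt_mul_of_pos_right ‹s < s'› hθ0
  linarith

theorem WeakCarousel.supportValue_sub_of_nonneg {K : Set Plane} (hK : IsCompact K)
    (hne : K.Nonempty) (hW : WeakCarousel IsometricSets K) {p q : ℝ} (hp : 0 ≤ p) (hq : 0 < q) :
    supportValue K (-p) q - supportValue K (-p) (-q) =
      q * (supportValue K 0 1 - supportValue K 0 (-1)) := by
  have cK := @Continuous.supportValue K hK ℝ _
  obtain ⟨c, hc⟩ : ∃ c, c = (supportValue K (-1) 1 - supportValue K (-1) (-1)) / 1 := ⟨_, rfl⟩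
  have hpos : ∀ p q, 0 < p → 0 < q →
      supportValue K (-p) q - supportValue K (-p) (-q) = q * c := fun p q hp hq => by
    have h := le_antisymm (hW.supportValue_slope_le hK hne hp hq one_pos one_pos)
      (hW.supportValue_slope_le hK hne one_pos one_pos hp hq)
    rw [← hc, div_eq_iff hq.ne'] at h
    linarith
  -- Letting p → 0 identifies the common slope c with the asymmetry in the vertical direction.
  have hzero : ∀ q, 0 < q → supportValue K 0 q - supportValue K 0 (-q) = q * c := fun q hq => by
    have hcont : Continuous fun p => supportValue K (-p) q - supportValue K (-p) (-q) :=
      (cK continuous_neg continuous_const).sub (cK continuous_neg continuous_const)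
    have h₁ := (hcont.tendsto 0).mono_left (nhdsWithin_le_nhds (s := Ioi 0))
    have h₂ : Tendsto (fun p => supportValue K (-p) q - supportValue K (-p) (-q)) (𝓝[>] 0)
        (𝓝 (q * c)) := by
      refine tendsto_const_nhds.congr' ?_
      filter_upwards [eventually_mem_nhdsWithin] with p hp
      exact (hpos p q hp hq).symm
    simpa using tendsto_nhds_unique h₁ h₂
  have h1 := hzero 1 one_pos
  rw [one_mul] at h1
  rw [h1]
  rcases hp.eq_or_lt with rfl | hp
  · simpa using hzero q hq
  · exact hpos p q hp hq

theorem WeakCarousel.supportValue_sub {K : Set Plane} (hK : IsCompact K) (hne : K.Nonempty)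
    (hW : WeakCarousel IsometricSets K) (a b : ℝ) :
    supportValue K a b - supportValue K a (-b) =
      b * (supportValue K 0 1 - supportValue K 0 (-1)) := by
  have hpos : ∀ a b, 0 < b → supportValue K a b - supportValue K a (-b) =
      b * (supportValue K 0 1 - supportValue K 0 (-1)) := by
    intro a b hb
    rcases le_total a 0 with ha | ha
    · simpa using hW.supportValue_sub_of_nonneg hK hne (neg_nonneg.2 ha) hb
    -- Reflection in the vertical axis swaps the sign of `a`.
    · have := WeakCarousel.supportValue_sub_of_nonneg (hK.image
        (planeIsometry (-1) 0 (-1) 0 0 (by norm_num) (by norm_num)).continuous) (hne.image _)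
        (hW.image _) ha hb
      simpa [supportValue_planeIsometry_image hK hne] using this
  rcases lt_trichotomy b 0 with hb | rfl | hb
  · have := hpos a (-b) (neg_pos.2 hb)
    rw [neg_neg] at this
    linarith
  · simp
  · exact hpos a b hb

/-! ### Symmetry axes in all directions force a disk. -/

theorem exists_half_angle {x y : ℝ} (h : x ^ 2 + y ^ 2 = 1) :
    ∃ c s : ℝ, c ^ 2 + s ^ 2 = 1 ∧ c ^ 2 - s ^ 2 = x ∧ 2 * c * s = y := by
  have hx : -1 ≤ x := by nlinarith
  rcases hx.eq_or_lt with rfl | hx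
  -- Here c = 0, so s cannot be obtained as y / (2c).
  · exact ⟨0, 1, by norm_num, by norm_num, by nlinarith⟩
  · have h0 : 0 < (1 + x) / 2 := by linarith
    have hc := Real.sq_sqrt h0.le
    have hcp := Real.sqrt_pos.2 h0
    obtain ⟨c, hce⟩ : ∃ c, c = √((1 + x) / 2) := ⟨_, rfl⟩
    rw [← hce] at hc hcp
    have hs : (y / (2 * c)) ^ 2 = (1 - x) / 2 := by
      rw [div_pow, mul_pow, hc, div_eq_iff (by linarith)]
      linarith
    exact ⟨c, y / (2 * c), by linarith, by linarith, by field_simp⟩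

/-- Symmetry in both coordinate axes gives central symmetry, so the symmetry axis in every direction
passes through the origin. The axis at half the angle of (x, y) carries (1, 0) to (x, y). -/
theorem WeakCarousel.supportValue_eq_of_centered {K : Set Plane} (hK : IsCompact K)
    (hne : K.Nonempty) (hW : WeakCarousel IsometricSets K)
    (h₀ : supportValue K 1 0 = supportValue K (-1) 0)
    (h₁ : supportValue K 0 1 = supportValue K 0 (-1)) {x y : ℝ} (h : x ^ 2 + y ^ 2 = 1) :
    supportValue K x y = supportValue K 1 0 := by
  have hrot : ∀ c s : ℝ, c ^ 2 + s ^ 2 = 1 → ∀ a b,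
      supportValue K (a * c + b * s) (b * c - a * s) -
        supportValue K (a * c - b * s) (-(b * c) - a * s) =
      b * (supportValue K s c - supportValue K (-s) (-c)) := by
    intro c s hcs a b
    have := WeakCarousel.supportValue_sub (hK.image
      (planeIsometry c s 1 0 0 hcs (by norm_num)).continuous) (hne.image _) (hW.image _) a b
    simpa [supportValue_planeIsometry_image hK hne, ← sub_eq_add_neg] using this
  have hy : ∀ a b, supportValue K a b = supportValue K a (-b) := fun a b => by
    have := hW.supportValue_sub hK hne a b
    rw [h₁, sub_self, mul_zero] at this
    exact sub_eq_zero.1 this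
  have hx : ∀ a b, supportValue K a b = supportValue K (-a) b := fun a b => by
    have := hrot 0 1 (by norm_num) (-b) a
    simp only [neg_zero, mul_zero, mul_one, zero_add, zero_sub, neg_neg, h₀, sub_self] at this
    exact sub_eq_zero.1 this
  obtain ⟨c, s, hcs, rfl, rfl⟩ := exists_half_angle h
  have := hrot c s hcs c s
  rw [← hy (-s) c, ← hx s c, sub_self, mul_zero] at this
  rw [hy]
  have e₁ : c * c + s * s = 1 := by linarith
  have e₂ : s * c - c * s = 0 := by ring
  have e₃ : c * c - s * s = c ^ 2 - s ^ 2 := by ring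
  have e₄ : -(s * c) - c * s = -(2 * c * s) := by ring
  rw [e₁, e₂, e₃, e₄] at this
  exact (sub_eq_zero.1 this).symm

theorem isDisk_of_supportValue {K : Set Plane} (hK : IsCompact K) (hne : K.Nonempty)
    (hc : Convex ℝ K) {c : Plane} {r : ℝ}
    (h : ∀ a b, a ^ 2 + b ^ 2 = 1 → supportValue K a b = planeForm a b c + r) : IsDisk K := by
  have hr : 0 ≤ r := by
    obtain ⟨z, hz⟩ := hne
    have i₁ := planeForm_le_supportValue hK 1 0 hz
    have i₂ := planeForm_le_supportValue hK (-1) 0 hz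
    rw [h _ _ (by norm_num)] at i₁ i₂
    simp only [planeForm] at i₁ i₂
    linarith
  refine ⟨c, r, hr, Subset.antisymm (fun x hx => ?_) fun x hx => ?_⟩
  · by_contra hn
    obtain ⟨a, b, hab, hlt⟩ := exists_unit_planeForm_lt ⟨c, mem_closedBall_self hr⟩
      (convex_closedBall c r) isClosed_closedBall hn
    obtain ⟨y, hy, hye⟩ := exists_mem_closedBall_planeForm_eq hab c hr
    have := (hlt y hy).trans_le (planeForm_le_supportValue hK a b hx)
    rw [h a b hab, hye] at this
    exact lt_irrefl _ this
  · by_contra hn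
    obtain ⟨a, b, hab, hlt⟩ := exists_unit_planeForm_lt hne hc hK.isClosed hn
    obtain ⟨y, hy, hye⟩ := exists_planeForm_eq_supportValue hK hne a b
    have := (hlt y hy).trans_le (planeForm_le_of_mem_closedBall hab hx)
    rw [hye, h a b hab] at this
    exact lt_irrefl _ this

theorem WeakCarousel.isDisk {K : Set Plane} (hK : IsCompact K) (hne : K.Nonempty)
    (hc : Convex ℝ K) (hW : WeakCarousel IsometricSets K) : IsDisk K := by
  -- The translation centering the bounding box of K at the origin.
  obtain ⟨t₁, ht₁⟩ : ∃ t, t = (supportValue K (-1) 0 - supportValue K 1 0) / 2 := ⟨_, rfl⟩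
  obtain ⟨t₂, ht₂⟩ : ∃ t, t = (supportValue K 0 (-1) - supportValue K 0 1) / 2 := ⟨_, rfl⟩
  obtain ⟨τ, hτ⟩ : ∃ τ, τ = planeIsometry 1 0 1 t₁ t₂ (by norm_num) (by norm_num) := ⟨_, rfl⟩
  have hs : ∀ a b, supportValue (τ '' K) a b = supportValue K a b + (a * t₁ + b * t₂) :=
    fun a b => by rw [hτ, supportValue_planeIsometry_image hK hne]; simp
  refine isDisk_of_supportValue hK hne hc (c := !₂[-t₁, -t₂]) (r := supportValue (τ '' K) 1 0)
    fun a b hab => ?_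
  rw [← WeakCarousel.supportValue_eq_of_centered (hK.image τ.continuous) (hne.image _)
    (hW.image τ) (by rw [hs, hs, ht₁]; ring) (by rw [hs, hs, ht₂]; ring) hab, hs]
  simp [planeForm]
  ring

theorem theorem1 (K₀ : Set Plane) (hne : K₀.Nonempty) (hcomp : IsCompact K₀)
    (hconv : Convex ℝ K₀) :
    List.TFAE
      [IsDisk K₀,
       WeakCarousel SimilarSets K₀,
       WeakCarousel IsometricSets K₀] := by
  tfae_have 1 → 2 := IsDisk.weakCarousel_similarSets
  tfae_have 2 → 3 := WeakCarousel.isometricSets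
  tfae_have 3 → 1 := fun h => h.isDisk hcomp hne hconv
  tfae_finish
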